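/- Let $k$ be an arbitrary field and let $h_\bullet=(h_0,h_1,h_2,\ldots)$ be a sequence of nonnegative integers with $h_0=1$. Put $h^{(0)}_d=h_d$ and, for $1\le i<h_1$, define inductively $h^{(i)}_0=1$ and $h^{(i)}_d=\max\{0,\,h^{(i-1)}_d-h^{(i-1)}_{d-1}\}$ for $d\ge 1$. For $0\le i<\max\{1,h_1\}$ let $r_i=\min\{d\ge 1 \mid h^{(i)}_d\le h^{(i)}_{d-1}\}$ (with $r_i=\infty$ if there is no such $d$), and let $D(h_\bullet)=\min\{i \mid 0\le i<\max\{1,h_1\},\ r_i<\infty\}$. The sequence $h_\bullet$ is called unimodal at each tail if for every $i$ with $D(h_\bullet)\le i<\max\{1,h_1\}$ one has $h^{(i)}_d\le h^{(i)}_{d-1}$ for all $d\ge r_i$. Order the monomials of $R=k[x_1,\ldots,x_n]$ by the degree reverse lexicographic order: $x^\alpha>x^\beta$ if and only if either $\deg x^\alpha>\deg x^\beta$, or $\deg x^\alpha=\deg x^\beta$ and there is an $s$ with $\alpha_i=\beta_i$ for all $i>s$ and $\alpha_s<\beta_s$. A monomial ideal $I\subseteq R$ (the zero ideal is allowed) is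 called almost reverse lexicographic if for every monomial $M$ of $R$ and every minimal monomial generator $N$ of $I$ with $\deg M=\deg N$ and $M>N$ one has $M\in I$. Write $H(R/I,d)=\dim_k (R/I)_d$ for the Hilbert function of $R/I$. Then $h_\bullet$ is unimodal at each tail if and only if there exist an integer $n\ge 1$ and an almost reverse lexicographic ideal $I$ of $R=k[x_1,\ldots,x_n]$ such that $H(R/I,d)=h_d$ for all $d\ge 0$. -/

import Mathlib

namespace AlmostRevLex

/-! ### Sequences that are unimodal at each tail -/

/-- The sequences `h⁽ⁱ⁾` attached to a sequence `h` of nonnegative integers: `h⁽⁰⁾ = h`, and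
`h⁽ⁱ⁺¹⁾_0 = 1`, `h⁽ⁱ⁺¹⁾_d = max {0, h⁽ⁱ⁾_d - h⁽ⁱ⁾_{d-1}}` for `d ≥ 1`.  The maximum with `0` is
exactly the truncated subtraction of natural numbers.  Only the indices `i < max {1, h_1}` are used
below. -/
def iterDiff (h : ℕ → ℕ) : ℕ → ℕ → ℕ
  | 0, d => h d
  | _ + 1, 0 => 1
  | i + 1, d + 1 => iterDiff h i (d + 1) - iterDiff h i d

/-- `r_i = min {d ≥ 1 | h⁽ⁱ⁾_d ≤ h⁽ⁱ⁾_{d-1}}`, with value `∞` when there is no such `d`. -/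
noncomputable def firstNonIncrease (h : ℕ → ℕ) (i : ℕ) : ℕ∞ :=
  sInf {r : ℕ∞ | ∃ d : ℕ, 1 ≤ d ∧ iterDiff h i d ≤ iterDiff h i (d - 1) ∧ r = (d : ℕ∞)}

/-- `D(h) = min {i | 0 ≤ i < max {1, h_1}, r_i < ∞}`.  When `h_0 = 1` this is the minimum of a
nonempty set. -/
noncomputable def tailStart (h : ℕ → ℕ) : ℕ :=
  sInf {i : ℕ | i < max 1 (h 1) ∧ firstNonIncrease h i < ⊤}

/-- A sequence `h` (with `h_0 = 1`) is unimodal at each tail if for every `i` with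
`D(h) ≤ i < max {1, h_1}` one has `h⁽ⁱ⁾_d ≤ h⁽ⁱ⁾_{d-1}` for all `d ≥ r_i`. -/
def IsUnimodalAtEachTail (h : ℕ → ℕ) : Prop :=
  ∀ i : ℕ, tailStart h ≤ i → i < max 1 (h 1) →
    ∀ d : ℕ, firstNonIncrease h i ≤ (d : ℕ∞) → iterDiff h i d ≤ iterDiff h i (d - 1)

/-! ### Almost reverse lexicographic ideals -/

/-- `DegRevLexGT a b` says that `x^a > x^b` in the degree reverse lexicographic order with
`x_1 > x_2 > ⋯ > x_n` (the variables are indexed by `Fin n`). -/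
def DegRevLexGT {n : ℕ} (a b : Fin n →₀ ℕ) : Prop :=
  b.degree < a.degree ∨
    (a.degree = b.degree ∧ ∃ s : Fin n, (∀ i : Fin n, s < i → a i = b i) ∧ a s < b s)

/-- An ideal of `k[x_1, …, x_n]` is monomial if it is generated by a set of monomials.  The zero
ideal (generated by the empty set) is monomial. -/
def IsMonomialIdeal {k : Type*} [Field k] {n : ℕ} (I : Ideal (MvPolynomial (Fin n) k)) : Prop :=
  ∃ S : Set (Fin n →₀ ℕ), I = Ideal.span ((fun a => MvPolynomial.monomial a (1 : k)) '' S)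

/-- `x^b` is a minimal generator of the monomial ideal `I`: it is minimal, with respect to
divisibility, among the monomials contained in `I`. -/
def IsMinimalGenerator {k : Type*} [Field k] {n : ℕ} (I : Ideal (MvPolynomial (Fin n) k))
    (b : Fin n →₀ ℕ) : Prop :=
  Minimal (fun c : Fin n →₀ ℕ => MvPolynomial.monomial c (1 : k) ∈ I) b

/-- A monomial ideal `I` is almost reverse lexicographic if for every monomial `x^a` and every
minimal generator `x^b` of `I` of the same degree, `x^a > x^b` implies `x^a ∈ I`. -/
def IsAlmostRevLex {k : Type*} [Field k] {n : ℕ} (I : Ideal (MvPolynomial (Fin n) k)) : Prop :=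
  IsMonomialIdeal I ∧
    ∀ a b : Fin n →₀ ℕ, IsMinimalGenerator I b → a.degree = b.degree → DegRevLexGT a b →
      MvPolynomial.monomial a (1 : k) ∈ I

/-! ### Hilbert functions -/

/-- The Hilbert function `H(R/I, d) = dim_k (R/I)_d`, where `(R/I)_d` is the image in `R/I` of the
space of homogeneous polynomials of degree `d` (and `0`). -/
noncomputable def hilbertFunction {k : Type*} [Field k] {n : ℕ}
    (I : Ideal (MvPolynomial (Fin n) k)) (d : ℕ) : ℕ :=
  Module.finrank k
    ((MvPolynomial.homogeneousSubmodule (Fin n) k d).map (Ideal.Quotient.mkₐ k I).toLinearMap)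

end AlmostRevLex

/-! A monomial ideal is replaced by the lower set `A` of exponents outside it, so that Hilbert
functions become counts. Necessity: in each degree, multiplication by the last variable on the
quotient is injective or surjective (`injective_or_surjective`). Hence setting that variable to zero
turns `h` into the truncated difference `h⁽¹⁾`, and iterating realises every `h⁽ⁱ⁾` by a standard
set in fewer variables. If `h⁽ⁱ⁾` fails to grow at some step, the next restriction vanishes there
and in all later degrees, so `h⁽ⁱ⁾` never grows again. Sufficiency: by induction on `h 1`, take `A`
realising `h⁽¹⁾` and adjoin a variable, keeping in degree `d` the `h d` smallest elements of `A` of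
degree at most `d`, padded with powers of the new variable (`extend`). Unimodality of `h` itself
makes this a lower set. -/

open MvPolynomial

namespace AlmostRevLex

/-! ### Appending an exponent for the last variable -/

/-- The exponent vector with initial part `M` and last exponent `j`. -/
noncomputable def snoc {n : ℕ} (M : Fin n →₀ ℕ) (j : ℕ) : Fin (n + 1) →₀ ℕ :=
  Finsupp.equivFunOnFinite.symm (Fin.snoc (α := fun _ => ℕ) M j)

/-- Dropping the last exponent. -/
noncomputable def dropLast {n : ℕ} (a : Fin (n + 1) →₀ ℕ) : Fin n →₀ ℕ :=
  Finsupp.equivFunOnFinite.symm (fun i => a i.castSucc)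

section Snoc

variable {n : ℕ}

@[simp] lemma snoc_castSucc (M : Fin n →₀ ℕ) (j : ℕ) (i : Fin n) :
    snoc M j i.castSucc = M i := by simp [snoc]

@[simp] lemma snoc_last (M : Fin n →₀ ℕ) (j : ℕ) : snoc M j (Fin.last n) = j := by simp [snoc]

@[simp] lemma dropLast_snoc (M : Fin n →₀ ℕ) (j : ℕ) : dropLast (snoc M j) = M := by
  ext i; simp [dropLast]

lemma exists_eq_snoc (a : Fin (n + 1) →₀ ℕ) : ∃ M j, a = snoc M j := by
  refine ⟨dropLast a, a (Fin.last n), ?_⟩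
  ext i
  induction i using Fin.lastCases <;> simp [dropLast]

@[simp] lemma snoc_inj {M N : Fin n →₀ ℕ} {i j : ℕ} : snoc M i = snoc N j ↔ M = N ∧ i = j := by
  refine ⟨fun e => ⟨?_, ?_⟩, fun e => by rw [e.1, e.2]⟩
  · simpa using congrArg dropLast e
  · simpa using DFunLike.congr_fun e (Fin.last n)

@[simp] lemma degree_snoc (M : Fin n →₀ ℕ) (j : ℕ) : (snoc M j).degree = M.degree + j := by
  simp [Finsupp.degree_eq_sum, Fin.sum_univ_castSucc]

@[simp] lemma snoc_le_snoc {M N : Fin n →₀ ℕ} {i j : ℕ} :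
    snoc M i ≤ snoc N j ↔ M ≤ N ∧ i ≤ j := by
  simp [Finsupp.le_def, Fin.forall_fin_succ']

@[simp] lemma snoc_zero_zero : snoc (0 : Fin n →₀ ℕ) 0 = 0 := by
  ext i
  induction i using Fin.lastCases <;> simp

end Snoc

/-! ### The degree reverse lexicographic order -/

section Order

variable {n : ℕ}

lemma DegRevLexGT.irrefl (a : Fin n →₀ ℕ) : ¬ DegRevLexGT a a := by
  simp [DegRevLexGT]

lemma DegRevLexGT.degree_le {a b : Fin n →₀ ℕ} (h : DegRevLexGT a b) : b.degree ≤ a.degree := by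
  rcases h with h | h
  · exact h.le
  · exact h.1.ge

lemma DegRevLexGT.trans {a b c : Fin n →₀ ℕ} (hab : DegRevLexGT a b) (hbc : DegRevLexGT b c) :
    DegRevLexGT a c := by
  rcases hab with hab | ⟨hab, s, hs, hs'⟩
  · exact Or.inl (hbc.degree_le.trans_lt hab)
  rcases hbc with hbc | ⟨hbc, t, ht, ht'⟩
  · exact Or.inl (hbc.trans_eq hab.symm)
  refine Or.inr ⟨hab.trans hbc, max s t, fun i hi => ?_, ?_⟩
  · rw [hs i ((le_max_left _ _).trans_lt hi), ht i ((le_max_right _ _).trans_lt hi)]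
  · rcases lt_trichotomy s t with h | rfl | h
    · rw [max_eq_right h.le, hs t h]; exact ht'
    · rw [max_self]; exact hs'.trans ht'
    · rw [max_eq_left h.le, ← ht s h]; exact hs'

lemma degRevLexGT_trichotomy (a b : Fin n →₀ ℕ) : DegRevLexGT a b ∨ a = b ∨ DegRevLexGT b a := by
  rcases lt_trichotomy a.degree b.degree with h | h | h
  · exact Or.inr (Or.inr (Or.inl h))
  · by_cases hab : a = b
    · exact Or.inr (Or.inl hab)
    have hne : (Finset.univ.filter fun i => a i ≠ b i).Nonempty := by
      obtain ⟨i, hi⟩ := DFunLike.ne_iff.mp hab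
      exact ⟨i, by simpa using hi⟩
    set s := (Finset.univ.filter fun i => a i ≠ b i).max' hne with hs
    have hs1 : a s ≠ b s := by simpa using Finset.max'_mem _ hne
    have hs2 : ∀ i, s < i → a i = b i := by
      intro i hi
      by_contra hne'
      exact absurd (Finset.le_max' _ i (by simpa using hne')) (not_le.mpr hi)
    rcases lt_or_gt_of_ne hs1 with h1 | h1
    · exact Or.inl (Or.inr ⟨h, s, hs2, h1⟩)
    · exact Or.inr (Or.inr (Or.inr ⟨h.symm, s, fun i hi => (hs2 i hi).symm, h1⟩))
  · exact Or.inl (Or.inl h)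

lemma degRevLexGT_of_lt {a b : Fin n →₀ ℕ} (h : a < b) : DegRevLexGT b a := by
  refine Or.inl ((Finsupp.degree_mono h.le).lt_of_ne fun e => h.ne ?_)
  rw [Finsupp.degree_eq_sum, Finsupp.degree_eq_sum,
    Finset.sum_eq_sum_iff_of_le fun i _ => h.le i] at e
  ext i
  exact e i (Finset.mem_univ i)

lemma degRevLexGT_snoc_of_lt {M N : Fin n →₀ ℕ} {i j : ℕ}
    (hd : (snoc M i).degree = (snoc N j).degree) (hij : i < j) :
    DegRevLexGT (snoc M i) (snoc N j) :=
  Or.inr ⟨hd, Fin.last n, fun i hi => absurd (Fin.le_last i) (not_le.mpr hi), by simpa using hij⟩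

lemma DegRevLexGT.snoc {M N : Fin n →₀ ℕ} (h : DegRevLexGT M N) (j : ℕ) :
    DegRevLexGT (snoc M j) (snoc N j) := by
  rcases h with h | ⟨hd, s, hs, hs'⟩
  · exact Or.inl (by simpa using h)
  · refine Or.inr ⟨by simpa using hd, s.castSucc, fun i hi => ?_, by simpa using hs'⟩
    induction i using Fin.lastCases with
    | last => simp
    | cast i => simpa using hs i (by simpa using hi)

/-- In a fixed total degree, a smaller last exponent means an initial part of larger degree, so
comparing monomials amounts to comparing initial parts. This is why `rank` only looks at the latter.
-/
lemma DegRevLexGT.of_snoc {M N : Fin n →₀ ℕ} {i j : ℕ}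
    (hd : (AlmostRevLex.snoc M i).degree = (AlmostRevLex.snoc N j).degree)
    (h : DegRevLexGT (AlmostRevLex.snoc M i) (AlmostRevLex.snoc N j)) :
    i ≤ j ∧ DegRevLexGT M N := by
  rcases h with h | ⟨-, s, hs, hs'⟩
  · exact absurd hd h.ne'
  rw [degree_snoc, degree_snoc] at hd
  induction s using Fin.lastCases with
  | last =>
    rw [snoc_last, snoc_last] at hs'
    exact ⟨hs'.le, Or.inl (by omega)⟩
  | cast s =>
    have hij : i = j := by simpa using hs (Fin.last n) (Fin.castSucc_lt_last s)
    refine ⟨hij.le, Or.inr ⟨by omega, s, fun t ht => ?_, by simpa using hs'⟩⟩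
    simpa using hs t.castSucc (by simpa using ht)

end Order

/-! ### Sets of standard monomials -/

/-- `A` is the set of exponents of the monomials outside some almost reverse lexicographic
ideal. -/
def IsStandardSet {n : ℕ} (A : Set (Fin n →₀ ℕ)) : Prop :=
  IsLowerSet A ∧ ∀ a b : Fin n →₀ ℕ, Minimal (fun c => c ∉ A) b → a.degree = b.degree →
    DegRevLexGT a b → a ∉ A

/-- The number of elements of degree `d` in a set of exponents. -/
noncomputable def count {n : ℕ} (A : Set (Fin n →₀ ℕ)) (d : ℕ) : ℕ :=
  {a | a ∈ A ∧ a.degree = d}.ncard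

section StandardSets

variable {n : ℕ}

lemma finite_mem_degree_eq (A : Set (Fin n →₀ ℕ)) (d : ℕ) : {a | a ∈ A ∧ a.degree = d}.Finite :=
  (Finsupp.finite_of_degree_eq d).subset fun _ h => h.2

lemma finite_mem_degree_le (A : Set (Fin n →₀ ℕ)) (d : ℕ) : {a | a ∈ A ∧ a.degree ≤ d}.Finite :=
  (Finsupp.finite_of_degree_le d).subset fun _ h => h.2

lemma count_eq_zero {A : Set (Fin n →₀ ℕ)} {d : ℕ} :
    count A d = 0 ↔ ∀ a ∈ A, a.degree ≠ d := by
  rw [count, Set.ncard_eq_zero (finite_mem_degree_eq A d), Set.eq_empty_iff_forall_notMem]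
  simp

lemma count_zero {A : Set (Fin n →₀ ℕ)} (h0 : 0 ∈ A) : count A 0 = 1 := by
  rw [count, Set.ncard_eq_one]
  refine ⟨0, Set.ext fun a => ?_⟩
  simp only [Finsupp.degree_eq_zero_iff, Set.mem_ofPred_eq, Set.mem_singleton_iff]
  exact ⟨fun h => h.2, fun h => ⟨h ▸ h0, h⟩⟩

lemma count_eq_zero_mono {A : Set (Fin n →₀ ℕ)} (hA : IsLowerSet A) {d e : ℕ} (hde : d ≤ e)
    (h : count A d = 0) : count A e = 0 := by
  rw [count_eq_zero] at h ⊢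
  rintro a ha rfl
  obtain ⟨b, hb, hd⟩ := Finsupp.exists_le_degree_eq a d hde
  exact h b (hA hb ha) hd

lemma ncard_degree_le (A : Set (Fin n →₀ ℕ)) (d : ℕ) :
    {a | a ∈ A ∧ a.degree ≤ d}.ncard = ∑ j ∈ Finset.range (d + 1), count A j := by
  induction d with
  | zero => simp [count]
  | succ d ih =>
    rw [Finset.sum_range_succ, ← ih, count, ← Set.ncard_union_eq _ (finite_mem_degree_le A d)
      (finite_mem_degree_eq A (d + 1))]
    · congr 1
      ext a
      simp only [Set.mem_ofPred_eq, Set.mem_union, ← and_or_left]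
      exact and_congr_right fun _ => by omega
    · rw [Set.disjoint_left]
      rintro a ⟨-, ha⟩ ⟨-, ha'⟩
      omega

/-- The section of `A` by the hyperplane where the last exponent vanishes. -/
def restrict (A : Set (Fin (n + 1) →₀ ℕ)) : Set (Fin n →₀ ℕ) := {M | snoc M 0 ∈ A}

lemma IsStandardSet.restrict {A : Set (Fin (n + 1) →₀ ℕ)} (hA : IsStandardSet A) :
    IsStandardSet (restrict A) := by
  refine ⟨fun M N hle hM => hA.1 (by simpa using hle) hM, fun M N hN hd hlt => ?_⟩
  refine hA.2 _ (snoc N 0) ⟨hN.1, fun c hc hle => ?_⟩ (by simpa using hd) (hlt.snoc 0)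
  obtain ⟨P, j, rfl⟩ := exists_eq_snoc c
  rw [snoc_le_snoc] at hle ⊢
  obtain rfl : j = 0 := by omega
  exact ⟨hN.2 hc hle.1, le_rfl⟩

lemma count_succ (A : Set (Fin (n + 1) →₀ ℕ)) (hA : IsLowerSet A) (d : ℕ) :
    count A (d + 1) = count (restrict A) (d + 1) +
      {a | (a ∈ A ∧ a.degree = d) ∧ a + Finsupp.single (Fin.last n) 1 ∈ A}.ncard := by
  have hinj : Function.Injective fun M : Fin n →₀ ℕ => snoc M 0 := fun M N h => by simpa using h
  rw [count, count, ← Set.ncard_image_of_injective _ hinj,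
    ← Set.ncard_image_of_injective {a | (a ∈ A ∧ a.degree = d) ∧ _}
      (add_left_injective (Finsupp.single (Fin.last n) 1)),
    ← Set.ncard_union_eq _ ((finite_mem_degree_eq _ _).image _)
      (((finite_mem_degree_eq A d).subset fun _ h => h.1).image _)]
  · congr 1
    ext a
    obtain ⟨M, j, rfl⟩ := exists_eq_snoc a
    simp only [Set.mem_ofPred_eq, Set.mem_union, Set.mem_image, restrict, snoc_inj]
    constructor
    · rintro ⟨h1, h2⟩
      rcases j with _ | j
      · exact Or.inl ⟨M, ⟨h1, by simpa using h2⟩, rfl, rfl⟩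
      · have e : snoc M j + Finsupp.single (Fin.last n) 1 = snoc M (j + 1) := by
          ext i
          induction i using Fin.lastCases with
          | last => simp
          | cast i => simp
        refine Or.inr ⟨snoc M j, ⟨⟨hA (by simp) h1, ?_⟩, e ▸ h1⟩, e⟩
        rw [degree_snoc] at h2 ⊢
        omega
    · rintro (⟨N, ⟨h1, h2⟩, rfl, rfl⟩ | ⟨b, ⟨⟨h1, h2⟩, h3⟩, h4⟩)
      · exact ⟨h1, by simpa using h2⟩
      · rw [← h4]
        exact ⟨h3, by rw [map_add, h2, Finsupp.degree_single]⟩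
  · rw [Set.disjoint_left]
    rintro _ ⟨M, -, rfl⟩ ⟨b, -, h⟩
    have := DFunLike.congr_fun h (Fin.last n)
    simp at this

/-- Multiplication by the last variable is injective or surjective in every degree. -/
lemma IsStandardSet.injective_or_surjective {A : Set (Fin (n + 1) →₀ ℕ)} (hA : IsStandardSet A)
    (d : ℕ) : (∀ a ∈ A, a.degree = d → a + Finsupp.single (Fin.last n) 1 ∈ A) ∨
      count (AlmostRevLex.restrict A) (d + 1) = 0 := by
  by_contra! hcon
  obtain ⟨⟨a, ha, hd, hna⟩, hc⟩ := hcon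
  apply hc
  rw [count_eq_zero]
  intro M hM hMd
  -- A minimal generator dividing `a` times the last variable must involve that variable, or it
  -- would divide `a`. It is then smaller than every monomial of its degree free of that variable,
  -- so all of those lie in the ideal.
  obtain ⟨b, hb, hbmin⟩ := exists_minimal_le_of_wellFoundedLT (fun c => c ∉ A) _ hna
  obtain ⟨N, j, rfl⟩ := exists_eq_snoc b
  have hj : 0 < j := by
    by_contra hj
    obtain rfl : j = 0 := by omega
    refine hbmin.1 (hA.1 (fun i => ?_) ha)
    have := hb i
    induction i using Fin.lastCases with
    | last => simp
    | cast i => simpa [Finsupp.single_apply, (Fin.castSucc_lt_last i).ne'] using this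
  have hdeg : (snoc N j).degree ≤ M.degree := by
    have := Finsupp.degree_mono hb
    rw [map_add, Finsupp.degree_single] at this
    omega
  obtain ⟨P, hP, hPd⟩ := Finsupp.exists_le_degree_eq M _ hdeg
  have hPd' : (snoc P 0).degree = (snoc N j).degree := by rw [← hPd]; simp
  exact hA.2 _ _ hbmin hPd' (degRevLexGT_snoc_of_lt hPd' hj) (hA.1 (by simpa using hP) hM)

lemma IsStandardSet.count_restrict_succ {A : Set (Fin (n + 1) →₀ ℕ)} (hA : IsStandardSet A)
    (d : ℕ) : count (AlmostRevLex.restrict A) (d + 1) = count A (d + 1) - count A d := by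
  have h := count_succ A hA.1 d
  have hle : {a | (a ∈ A ∧ a.degree = d) ∧ a + Finsupp.single (Fin.last n) 1 ∈ A}.ncard ≤
      count A d := Set.ncard_le_ncard (fun _ h => h.1) (finite_mem_degree_eq A d)
  rcases hA.injective_or_surjective d with h1 | h1
  · have : {a | (a ∈ A ∧ a.degree = d) ∧ a + Finsupp.single (Fin.last n) 1 ∈ A} =
        {a | a ∈ A ∧ a.degree = d} := by
      ext a
      simpa using h1 a
    rw [this, ← count] at h
    omega
  · omega

/-- Failure to grow means that the restriction is empty in degree `d + 1`; being a lower set, it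
stays empty above. -/
lemma IsStandardSet.count_succ_le {A : Set (Fin (n + 1) →₀ ℕ)} (hA : IsStandardSet A)
    {d e : ℕ} (hde : d ≤ e) (h : count A (d + 1) ≤ count A d) :
    count A (e + 1) ≤ count A e := by
  have h1 := hA.count_restrict_succ d
  have h2 := count_eq_zero_mono hA.restrict.1 (Nat.succ_le_succ hde)
    (h1.trans (Nat.sub_eq_zero_of_le h))
  have h3 := hA.count_restrict_succ e
  simp only [Nat.succ_eq_add_one] at h2
  omega

end StandardSets

/-! ### Iterated differences -/

lemma iterDiff_iterDiff_one {h : ℕ → ℕ} (i d : ℕ) :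
    iterDiff (iterDiff h 1) i d = iterDiff h (i + 1) d := by
  induction i generalizing d with
  | zero => rfl
  | succ i ih =>
    cases d with
    | zero => rfl
    | succ d => simp only [iterDiff, ih]

lemma exists_isStandardSet_iterDiff {n : ℕ} {A : Set (Fin n →₀ ℕ)} (hA : IsStandardSet A)
    (h0 : 0 ∈ A) {i : ℕ} (hi : i ≤ n) : ∃ B : Set (Fin (n - i) →₀ ℕ),
      IsStandardSet B ∧ 0 ∈ B ∧ ∀ d, iterDiff (count A) i d = count B d := by
  induction i generalizing n A with
  | zero => exact ⟨A, hA, h0, fun d => rfl⟩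
  | succ i ih =>
    obtain ⟨n, rfl⟩ : ∃ m, n = m + 1 := ⟨n - 1, by omega⟩
    have h0' : 0 ∈ restrict A := by simpa [restrict] using h0
    have e : iterDiff (count A) 1 = count (restrict A) := by
      funext d
      cases d with
      | zero => simp [iterDiff, count_zero h0']
      | succ d => simp [iterDiff, hA.count_restrict_succ]
    obtain ⟨B, hB, hB0, hBd⟩ := ih hA.restrict h0' (by omega)
    rw [Nat.add_sub_add_right]
    exact ⟨B, hB, hB0, fun d => by rw [← iterDiff_iterDiff_one, e, hBd]⟩

/-- A reformulation of unimodality at each tail without the infinite values. -/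
lemma isUnimodalAtEachTail_iff {h : ℕ → ℕ} : IsUnimodalAtEachTail h ↔
    ∀ i < max 1 (h 1), ∀ d e, d ≤ e → iterDiff h i (d + 1) ≤ iterDiff h i d →
      iterDiff h i (e + 1) ≤ iterDiff h i e := by
  constructor
  · intro H i hi d e hde hd
    have hr : firstNonIncrease h i ≤ ((d + 1 : ℕ) : ℕ∞) :=
      sInf_le ⟨d + 1, by omega, by simpa using hd, rfl⟩
    refine H i (Nat.sInf_le ⟨hi, hr.trans_lt (ENat.natCast_lt_top _)⟩) hi (e + 1) (hr.trans ?_)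
    exact_mod_cast Nat.succ_le_succ hde
  · intro H i _ hi e he
    have hne : {r : ℕ∞ | ∃ d : ℕ, 1 ≤ d ∧ iterDiff h i d ≤ iterDiff h i (d - 1) ∧
        r = (d : ℕ∞)}.Nonempty := by
      by_contra hne
      rw [firstNonIncrease, Set.not_nonempty_iff_eq_empty.mp hne, sInf_empty] at he
      exact absurd he (not_le.mpr (ENat.natCast_lt_top e))
    obtain ⟨d, hd1, hd2, hd3⟩ := csInf_mem hne
    have hde : d ≤ e := by
      rw [firstNonIncrease, hd3] at he
      exact_mod_cast he
    have := H i hi (d - 1) (e - 1) (by omega) (by rwa [Nat.sub_add_cancel hd1])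
    rwa [Nat.sub_add_cancel (hd1.trans hde)] at this

lemma count_one_le {n : ℕ} (A : Set (Fin n →₀ ℕ)) : count A 1 ≤ n := by
  calc count A 1 ≤ (Set.range fun i : Fin n => Finsupp.single i 1).ncard := by
        rw [Finsupp.range_single_one]
        exact Set.ncard_le_ncard (fun _ h => h.2) (Finsupp.finite_of_degree_eq 1)
    _ ≤ n := by
        rw [← Set.image_univ]
        exact (Set.ncard_image_le Set.finite_univ).trans (by simp [Set.ncard_univ])

lemma IsStandardSet.isUnimodalAtEachTail_count {n : ℕ} (hn : 1 ≤ n) {A : Set (Fin n →₀ ℕ)}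
    (hA : IsStandardSet A) (h0 : 0 ∈ A) : IsUnimodalAtEachTail (count A) := by
  rw [isUnimodalAtEachTail_iff]
  intro i hi d e hde h
  -- At least one variable survives `i` restrictions, as `count_succ_le` needs.
  have hin : i < n := hi.trans_le (max_le hn (count_one_le A))
  obtain ⟨m, hm⟩ : ∃ m, n - i = m + 1 := ⟨n - i - 1, by omega⟩
  have hB := exists_isStandardSet_iterDiff hA h0 hin.le
  rw [hm] at hB
  obtain ⟨B, hB, -, hBd⟩ := hB
  simp only [hBd] at h ⊢
  exact hB.count_succ_le hde h

/-! ### Extending a standard set by one variable -/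

section Extend

variable {n : ℕ}

/-- The number of elements of `A` below `M` in the degree reverse lexicographic order. -/
noncomputable def rank (A : Set (Fin n →₀ ℕ)) (M : Fin n →₀ ℕ) : ℕ :=
  {N | N ∈ A ∧ DegRevLexGT M N}.ncard

lemma finite_mem_degRevLexGT (A : Set (Fin n →₀ ℕ)) (M : Fin n →₀ ℕ) :
    {N | N ∈ A ∧ DegRevLexGT M N}.Finite :=
  (finite_mem_degree_le A M.degree).subset fun _ h => ⟨h.1, h.2.degree_le⟩

lemma rank_lt_rank {A : Set (Fin n →₀ ℕ)} {M N : Fin n →₀ ℕ} (hN : N ∈ A)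
    (h : DegRevLexGT M N) : rank A N < rank A M := by
  refine Set.ncard_lt_ncard ⟨fun P hP => ⟨hP.1, h.trans hP.2⟩, fun hsub => ?_⟩
    (finite_mem_degRevLexGT A M)
  exact DegRevLexGT.irrefl N (hsub ⟨hN, h⟩).2

lemma rank_le_rank {A : Set (Fin n →₀ ℕ)} {M N : Fin n →₀ ℕ} (hN : N ∈ A)
    (h : N ≤ M) : rank A N ≤ rank A M := by
  rcases h.eq_or_lt with rfl | h
  · exact le_rfl
  · exact (rank_lt_rank hN (degRevLexGT_of_lt h)).le

lemma rank_injOn (A : Set (Fin n →₀ ℕ)) : Set.InjOn (rank A) A := by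
  intro M hM N hN h
  rcases degRevLexGT_trichotomy M N with h' | h' | h'
  · exact absurd h (rank_lt_rank hN h').ne'
  · exact h'
  · exact absurd h (rank_lt_rank hM h').ne

lemma rank_lt_ncard {A : Set (Fin n →₀ ℕ)} {M : Fin n →₀ ℕ} (hM : M ∈ A) {d : ℕ}
    (hd : M.degree ≤ d) : rank A M < {a | a ∈ A ∧ a.degree ≤ d}.ncard := by
  refine Set.ncard_lt_ncard ⟨fun N hN => ⟨hN.1, hN.2.degree_le.trans hd⟩, fun hsub => ?_⟩
    (finite_mem_degree_le A d)
  exact DegRevLexGT.irrefl M (hsub ⟨hM, hd⟩).2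

/-- The order compares degrees first, so the elements of degree at most `d` form an initial segment
of `A`, and `rank` numbers them consecutively from 0. -/
lemma ncard_rank_lt (A : Set (Fin n →₀ ℕ)) {d m : ℕ}
    (hm : m ≤ {a | a ∈ A ∧ a.degree ≤ d}.ncard) :
    {a | (a ∈ A ∧ a.degree ≤ d) ∧ rank A a < m}.ncard = m := by
  set S := {a | a ∈ A ∧ a.degree ≤ d} with hS
  have hinj : Set.InjOn (rank A) S := (rank_injOn A).mono fun _ h => h.1
  have himg : rank A '' S = Set.Iio S.ncard := by
    refine Set.eq_of_subset_of_ncard_le ?_ ?_ (Set.finite_Iio _)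
    · rintro _ ⟨a, ha, rfl⟩
      exact rank_lt_ncard ha.1 ha.2
    · rw [hinj.ncard_image]
      simp [Set.ncard_eq_toFinset_card']
  have : rank A '' {a | a ∈ S ∧ rank A a < m} = Set.Iio m := by
    ext r
    constructor
    · rintro ⟨a, ha, rfl⟩
      exact ha.2
    · intro hr
      obtain ⟨a, ha, rfl⟩ : r ∈ rank A '' S := himg ▸ lt_of_lt_of_le hr hm
      exact ⟨a, ⟨ha, hr⟩, rfl⟩
  have hinj' : Set.InjOn (rank A) {a | a ∈ S ∧ rank A a < m} := hinj.mono fun _ h => h.1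
  change {a | a ∈ S ∧ rank A a < m}.ncard = m
  rw [← hinj'.ncard_image, this]
  simp [Set.ncard_eq_toFinset_card', Set.toFinset_Iio]

/-- In degree `d`, the `h d` smallest elements of `A`, completed by powers of the last variable. -/
def extend (A : Set (Fin n →₀ ℕ)) (h : ℕ → ℕ) : Set (Fin (n + 1) →₀ ℕ) :=
  {a | dropLast a ∈ A ∧ rank A (dropLast a) < h a.degree}

lemma snoc_mem_extend {A : Set (Fin n →₀ ℕ)} {h : ℕ → ℕ} {M : Fin n →₀ ℕ} {j : ℕ} :
    snoc M j ∈ extend A h ↔ M ∈ A ∧ rank A M < h (M.degree + j) := by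
  simp [extend]

lemma count_extend (A : Set (Fin n →₀ ℕ)) (h : ℕ → ℕ) {d : ℕ}
    (hd : h d ≤ ∑ j ∈ Finset.range (d + 1), count A j) : count (extend A h) d = h d := by
  rw [← ncard_degree_le] at hd
  rw [← ncard_rank_lt A hd, count]
  have hinj : Set.InjOn (fun M : Fin n →₀ ℕ => snoc M (d - M.degree))
      {a | (a ∈ A ∧ a.degree ≤ d) ∧ rank A a < h d} := by
    intro M _ N _ e
    exact (snoc_inj.mp e).1
  rw [← hinj.ncard_image]
  congr 1
  ext a
  obtain ⟨M, j, rfl⟩ := exists_eq_snoc a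
  simp only [Set.mem_ofPred_eq, Set.mem_image, snoc_inj, snoc_mem_extend, degree_snoc]
  constructor
  · rintro ⟨⟨h1, h2⟩, rfl⟩
    exact ⟨M, ⟨⟨h1, by omega⟩, h2⟩, rfl, by omega⟩
  · rintro ⟨N, ⟨⟨h1, h2⟩, h3⟩, rfl, rfl⟩
    rw [Nat.add_sub_cancel' h2]
    exact ⟨⟨h1, h3⟩, rfl⟩

lemma IsStandardSet.extend {A : Set (Fin n →₀ ℕ)} (hA : IsStandardSet A) {h : ℕ → ℕ}
    (hh : ∀ d e, d ≤ e → h d = ∑ j ∈ Finset.range (d + 1), count A j ∨ h e ≤ h d) :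
    IsStandardSet (extend A h) := by
  refine ⟨fun a b hba ha => ?_, fun a b hb hd hgt ha => ?_⟩
  · obtain ⟨M, i, rfl⟩ := exists_eq_snoc a
    obtain ⟨N, j, rfl⟩ := exists_eq_snoc b
    have hdeg := Finsupp.degree_mono hba
    rw [snoc_le_snoc] at hba
    rw [degree_snoc, degree_snoc] at hdeg
    rw [snoc_mem_extend] at ha ⊢
    have hN : N ∈ A := hA.1 hba.1 ha.1
    refine ⟨hN, ?_⟩
    -- Either all of `A` up to the smaller degree is kept, or the bound on the rank does not tighten
    -- when passing to a divisor.
    rcases hh _ _ hdeg with h1 | h1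
    · rw [h1, ← ncard_degree_le]
      exact rank_lt_ncard hN (by omega)
    · exact ((rank_le_rank hN hba.1).trans_lt ha.2).trans_le h1
  · obtain ⟨M, i, rfl⟩ := exists_eq_snoc a
    obtain ⟨N, j, rfl⟩ := exists_eq_snoc b
    obtain ⟨hij, hMN⟩ := DegRevLexGT.of_snoc hd hgt
    rw [degree_snoc, degree_snoc] at hd
    rw [snoc_mem_extend] at ha
    have hb1 : snoc N j ∉ AlmostRevLex.extend A h := hb.1
    rw [snoc_mem_extend, not_and, not_lt] at hb1
    -- If `N ∈ A`, the generator was excluded by its rank, and `M` has a larger one. Otherwise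
    -- minimality forces `j = 0`, and `N` is a minimal nonmember of `A`.
    by_cases hN : N ∈ A
    · have := rank_lt_rank hN hMN
      have := hb1 hN
      rw [hd] at ha
      omega
    · obtain rfl : j = 0 := by
        have : snoc N j ≤ snoc N 0 := hb.2 (by simp [snoc_mem_extend, hN]) (by simp)
        simpa using this
      obtain rfl : i = 0 := by omega
      refine hA.2 M N ⟨hN, fun P hP hPN => ?_⟩ (by omega) hMN ha.1
      have : snoc N 0 ≤ snoc P 0 := hb.2 (by simp [snoc_mem_extend, hP]) (by simpa using hPN)
      simpa using this

end Extend

lemma exists_isStandardSet_count_eq (n : ℕ) (h : ℕ → ℕ) (h0 : h 0 = 1) (hn : max 1 (h 1) = n + 1)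
    (H : IsUnimodalAtEachTail h) : ∃ A : Set (Fin (n + 1) →₀ ℕ),
      IsStandardSet A ∧ ∀ d, count A d = h d := by
  rw [isUnimodalAtEachTail_iff] at H
  induction n generalizing h with
  | zero =>
    have huniv : IsStandardSet (Set.univ : Set (Fin 0 →₀ ℕ)) :=
      ⟨isLowerSet_univ, fun a b hb => absurd (Set.mem_univ b) hb.1⟩
    -- Here `h 1 ≤ 1 = h 0`, so `h` already fails to grow at the first step.
    have hanti : Antitone h := antitone_nat_of_succ_le fun e =>
      H 0 (by omega) 0 e (by omega) (by simp only [iterDiff, zero_add]; omega)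
    refine ⟨extend Set.univ h, huniv.extend fun d e hde => Or.inr (hanti hde),
      fun d => count_extend _ _ ?_⟩
    calc h d ≤ h 0 := hanti (Nat.zero_le d)
      _ = count (Set.univ : Set (Fin 0 →₀ ℕ)) 0 := by rw [h0, count_zero (Set.mem_univ _)]
      _ ≤ _ := Finset.single_le_sum (f := count (Set.univ : Set (Fin 0 →₀ ℕ)))
          (fun _ _ => Nat.zero_le _) (by simp)
  | succ n ih =>
    have h1 : h 1 = n + 2 := by omega
    have hg1 : iterDiff h 1 1 = n + 1 := by simp [iterDiff, h0, h1]
    obtain ⟨A, hA, hAc⟩ := ih (iterDiff h 1) rfl (by rw [hg1]; omega) (by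
      intro i hi
      simp only [iterDiff_iterDiff_one]
      exact H (i + 1) (by omega))
    have hsucc : ∀ j, count A (j + 1) = h (j + 1) - h j := fun j => by rw [hAc]; rfl
    have h0A : count A 0 = 1 := hAc 0
    have hle : ∀ d, h d ≤ ∑ j ∈ Finset.range (d + 1), count A j := by
      intro d
      induction d with
      | zero => simp [h0, h0A]
      | succ d ihd => rw [Finset.sum_range_succ, hsucc]; omega
    refine ⟨extend A h, hA.extend fun d e hde => ?_, fun d => count_extend A h (hle d)⟩
    -- Without a descent before `d`, the truncated differences telescope to `h d`; after a descent,
    -- unimodality of `h` prevents any later growth.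
    by_cases hmono : ∀ j < d, h j ≤ h (j + 1)
    · left
      clear hde
      induction d with
      | zero => simp [h0, h0A]
      | succ d ihd =>
        have := hmono d (by omega)
        rw [Finset.sum_range_succ, hsucc, ← ihd fun j hj => hmono j (by omega)]
        omega
    · right
      push Not at hmono
      obtain ⟨j, hj, hlt⟩ := hmono
      induction e, hde using Nat.le_induction with
      | base => exact le_rfl
      | succ e hde ihe => exact (H 0 (by omega) j e (by omega) hlt.le).trans ihe

/-! ### Monomial ideals and their Hilbert functions -/

section Ideal

variable {k : Type*} [Field k] {n : ℕ}

/-- The exponents of the monomials outside an ideal. -/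
def standardMonomials (I : Ideal (MvPolynomial (Fin n) k)) : Set (Fin n →₀ ℕ) :=
  {a | monomial a (1 : k) ∉ I}

lemma isLowerSet_standardMonomials (I : Ideal (MvPolynomial (Fin n) k)) :
    IsLowerSet (standardMonomials I) := by
  intro a b hba ha hb
  refine ha (I.mem_of_dvd ?_ hb)
  rw [monomial_dvd_monomial]
  exact ⟨Or.inr hba, dvd_rfl⟩

lemma IsAlmostRevLex.isStandardSet {I : Ideal (MvPolynomial (Fin n) k)} (hI : IsAlmostRevLex I) :
    IsStandardSet (standardMonomials I) := by
  refine ⟨isLowerSet_standardMonomials I, fun a b hb hd hgt => ?_⟩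
  have hb' : IsMinimalGenerator I b := by simpa [standardMonomials, IsMinimalGenerator] using hb
  simpa [standardMonomials] using hI.2 a b hb' hd hgt

lemma IsMonomialIdeal.mem_iff {I : Ideal (MvPolynomial (Fin n) k)} (hI : IsMonomialIdeal I)
    {p : MvPolynomial (Fin n) k} : p ∈ I ↔ ∀ a ∈ p.support, monomial a (1 : k) ∈ I := by
  classical
  obtain ⟨S, rfl⟩ := hI
  rw [mem_ideal_span_monomial_image]
  refine forall₂_congr fun a _ => ?_
  rw [mem_ideal_span_monomial_image]
  simp [support_monomial]

lemma linearIndependent_standardMonomials {I : Ideal (MvPolynomial (Fin n) k)}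
    (hI : IsMonomialIdeal I) : LinearIndependent k
      fun a : standardMonomials I => Ideal.Quotient.mkₐ k I (monomial a.1 1) := by
  rw [linearIndependent_iff]
  intro l hl
  have hsum : Finsupp.linearCombination k
      (fun a : standardMonomials I => monomial a.1 (1 : k)) l ∈ I := by
    rw [← Ideal.Quotient.eq_zero_iff_mem, ← hl]
    exact Finsupp.apply_linearCombination k (Ideal.Quotient.mkₐ k I).toLinearMap _ l
  rw [hI.mem_iff] at hsum
  ext a
  by_contra hne
  -- A monomial ideal contains every monomial of its elements, so a standard monomial cannot occur
  -- in the combination.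
  refine a.2 (hsum a ?_)
  rw [mem_support_iff, Finsupp.linearCombination_apply, Finsupp.sum, coeff_sum]
  classical
  rw [Finset.sum_eq_single a]
  · simpa using hne
  · intro b _ hba
    simp [coeff_monomial, Subtype.coe_injective.ne hba]
  · intro ha
    simp [Finsupp.notMem_support_iff.mp ha]

lemma homogeneousSubmodule_eq_span_monomial (d : ℕ) : homogeneousSubmodule (Fin n) k d =
    Submodule.span k ((fun a => monomial a (1 : k)) '' {a | a.degree = d}) := by
  rw [homogeneousSubmodule_eq_finsupp_supported, AddMonoidAlgebra.supported_eq_span_single]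
  rfl

lemma hilbertFunction_eq_count {I : Ideal (MvPolynomial (Fin n) k)} (hI : IsMonomialIdeal I)
    (d : ℕ) : hilbertFunction I d = count (standardMonomials I) d := by
  set T := {a | a ∈ standardMonomials I ∧ a.degree = d} with hT
  have : Fintype T := (finite_mem_degree_eq (standardMonomials I) d).fintype
  have hli : LinearIndependent k fun a : T => Ideal.Quotient.mkₐ k I (monomial a.1 1) :=
    (linearIndependent_standardMonomials hI).comp (fun a : T => ⟨a.1, a.2.1⟩)
      fun a b h => Subtype.ext (congrArg (fun x : standardMonomials I => x.1) h)
  rw [count, ← hT, Set.ncard_eq_toFinset_card', Set.toFinset_card, ← finrank_span_eq_card hli,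
    hilbertFunction]
  suffices hspan : (homogeneousSubmodule (Fin n) k d).map (Ideal.Quotient.mkₐ k I).toLinearMap =
      Submodule.span k (Set.range fun a : T => Ideal.Quotient.mkₐ k I (monomial a.1 1)) by
    rw [hspan]
  rw [homogeneousSubmodule_eq_span_monomial, Submodule.map_span]
  apply le_antisymm
  · rw [Submodule.span_le]
    rintro _ ⟨_, ⟨a, ha, rfl⟩, rfl⟩
    by_cases hmem : monomial a (1 : k) ∈ I
    · have : Ideal.Quotient.mkₐ k I (monomial a 1) = 0 := Ideal.Quotient.eq_zero_iff_mem.mpr hmem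
      simp [this]
    · exact Submodule.subset_span ⟨⟨a, hmem, ha⟩, rfl⟩
  · apply Submodule.span_mono
    rintro _ ⟨a, rfl⟩
    exact ⟨_, ⟨a.1, a.2.2, rfl⟩, rfl⟩

/-- The monomial ideal spanned by the monomials outside a lower set. -/
noncomputable def complementIdeal (k : Type*) [Field k] (A : Set (Fin n →₀ ℕ)) :
    Ideal (MvPolynomial (Fin n) k) :=
  Ideal.span ((fun a => monomial a (1 : k)) '' Aᶜ)

lemma standardMonomials_complementIdeal {A : Set (Fin n →₀ ℕ)} (hA : IsLowerSet A) :
    standardMonomials (complementIdeal k A) = A := by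
  classical
  ext a
  rw [standardMonomials, Set.mem_ofPred_eq, complementIdeal, mem_ideal_span_monomial_image]
  simp only [support_monomial, one_ne_zero, if_false, Finset.mem_singleton, forall_eq,
    Set.mem_compl_iff, not_exists, not_and]
  exact ⟨fun h => by_contra fun ha => h a ha le_rfl, fun ha b hb hle => hb (hA hle ha)⟩

lemma IsStandardSet.isAlmostRevLex {A : Set (Fin n →₀ ℕ)} (hA : IsStandardSet A) :
    IsAlmostRevLex (complementIdeal k A) := by
  have hmem : ∀ a, monomial a (1 : k) ∈ complementIdeal k A ↔ a ∉ A := by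
    intro a
    conv_rhs => rw [← standardMonomials_complementIdeal (k := k) hA.1]
    simp [standardMonomials]
  refine ⟨⟨_, rfl⟩, fun a b hb hd hgt => ?_⟩
  rw [hmem]
  refine hA.2 a b ?_ hd hgt
  simpa only [IsMinimalGenerator, hmem] using hb

end Ideal

end AlmostRevLex

theorem corollary3p10 (k : Type*) [Field k] (h : ℕ → ℕ) (h0 : h 0 = 1) :
    AlmostRevLex.IsUnimodalAtEachTail h ↔
      ∃ n : ℕ, 1 ≤ n ∧ ∃ I : Ideal (MvPolynomial (Fin n) k),
        AlmostRevLex.IsAlmostRevLex I ∧ ∀ d : ℕ, AlmostRevLex.hilbertFunction I d = h d := by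
  open AlmostRevLex in
  constructor
  · intro H
    obtain ⟨n, hn⟩ : ∃ n, max 1 (h 1) = n + 1 := ⟨max 1 (h 1) - 1, by omega⟩
    obtain ⟨A, hA, hAc⟩ := exists_isStandardSet_count_eq n h h0 hn H
    refine ⟨n + 1, by omega, complementIdeal k A, hA.isAlmostRevLex, fun d => ?_⟩
    rw [hilbertFunction_eq_count hA.isAlmostRevLex.1, standardMonomials_complementIdeal hA.1, hAc]
  · rintro ⟨n, hn, I, hI, hc⟩
    have e : h = count (standardMonomials I) :=
      funext fun d => by rw [← hc, hilbertFunction_eq_count hI.1]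
    have h0A : 0 ∈ standardMonomials I := by
      have hne : count (standardMonomials I) 0 ≠ 0 := by rw [← e, h0]; exact one_ne_zero
      rw [Ne, count_eq_zero] at hne
      push Not at hne
      obtain ⟨a, ha, ha0⟩ := hne
      rwa [(Finsupp.degree_eq_zero_iff a).mp ha0] at ha
    rw [e]
    exact hI.isStandardSet.isUnimodalAtEachTail_count hn h0A
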